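/- Let $q$ be a prime power. For an $\mathbb F_q$-subspace $U$ of $\mathbb F_{q^4}^3$ of dimension $n$ over $\mathbb F_q$, the set of points $$L_U=\{\langle u\rangle_{\mathbb F_{q^4}} : u\in U\setminus\{0\}\}\subseteq \mathrm{PG}(2,q^4)$$ is called an $\mathbb F_q$-linear set of rank $n$. It is called $1$-saturating if every point of $\mathrm{PG}(2,q^4)$ lies on a line joining two distinct points of $L_U$. Let $s_{q^4/q}(3,2)$ denote the smallest rank of a $1$-saturating $\mathbb F_q$-linear set in $\mathrm{PG}(2,q^4)$. Then, for every prime power $q$, $$s_{q^4/q}(3,2)=5;$$ that is, there is a $1$-saturating $\mathbb F_q$-linear set of rank $5$ in $\mathrm{PG}(2,q^4)$, and there is none of rank less than $5$. -/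

import Mathlib

open scoped LinearAlgebra.Projectivization

/-- The linear set `L_U = {⟨u⟩_L : u ∈ U \ {0}}` of points of `PG(V, L)` defined by a
`K`-subspace `U` of the `L`-vector space `V`. Its rank is `dim_K U`. -/
def linearSet {K : Type*} (L : Type*) {V : Type*} [Field K] [Field L] [AddCommGroup V]
    [Module K V] [Module L V] (U : Submodule K V) : Set (ℙ L V) :=
  {P | ∃ (u : V) (hu : u ≠ 0), u ∈ U ∧ P = Projectivization.mk L u hu}

/-- A set `S` of points of `PG(V, L)` is `ρ`-saturating if every point of `PG(V, L)` lies in a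
projective subspace of dimension `ρ` spanned by `ρ + 1` points of `S`. (The span of `ρ + 1` points
has projective dimension `ρ` exactly when the points are independent; for `ρ = 1` this says that
every point lies on a line joining two distinct points of `S`.) -/
def IsSaturating {L V : Type*} [Field L] [AddCommGroup V] [Module L V] (ρ : ℕ)
    (S : Set (ℙ L V)) : Prop :=
  ∀ P : ℙ L V, ∃ p : Fin (ρ + 1) → ℙ L V,
    (∀ i, p i ∈ S) ∧ Projectivization.Independent p ∧
      P ∈ Projectivization.Subspace.span (Set.range p)

/-- The ranks of the `ρ`-saturating `K`-linear sets of `PG(k - 1, L) = PG(L ^ k, L)`. -/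
def saturatingRanks (K L : Type*) [Field K] [Field L] [Algebra K L] (k ρ : ℕ) : Set ℕ :=
  {n | ∃ U : Submodule K (Fin k → L), Module.finrank K U = n ∧ IsSaturating ρ (linearSet L U)}

/-! Lower bound: write a generating family of `U` as an `L`-linear map `F : L^4 → V`. Saturation
forces `F` to be onto, so its kernel is a line `L w`. A point `F x` lies on a line joining two
points of the linear set only if some `x - μ w` has the form `α c + β d` with `c, d` over `K`, that
is, has rank at most 2 as a `K`-map `K^4 → L`. But `exists_ker_sub_smul_finrank_le_one` gives, for
the map `φ` of `w`, a `ψ` at rank distance at least 3 from every `μ φ`. Upper bound: a quadratic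
subextension `F` gives a subplane whose secants cover the plane, and a `K`-hyperplane of `F^3`, of
dimension 6 - 1 = 5, still represents every point of it. -/

open Module

/-! ### Binomials in a Galois generator, and scaling of hyperplanes -/

section SemilinearKernel

variable {K L : Type*} [Field K] [Field L] [Algebra K L]

/-- The ratio of two nonzero kernel elements is fixed by `σ`, hence lies in `K`. -/
theorem finrank_ker_smul_add_smul_le_one (σ : Gal(L/K))
    (hσ : ∀ x : L, σ x = x → x ∈ Set.range (algebraMap K L)) {α β : L} (h : α ≠ 0 ∨ β ≠ 0) :
    finrank K (LinearMap.ker (α • σ.toLinearMap + β • (LinearMap.id : L →ₗ[K] L))) ≤ 1 := by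
  by_cases hbot : ∃ x : L, x ≠ 0 ∧ α * σ x + β * x = 0
  · obtain ⟨x, hx0, hx⟩ := hbot
    refine finrank_le_one ⟨x, by simpa using hx⟩ ?_
    rintro ⟨y, hy⟩
    replace hy : α * σ y + β * y = 0 := by simpa using hy
    have hα : α ≠ 0 := by
      rintro rfl
      have : β = 0 := by simpa [hx0] using hx
      simp [this] at h
    have hfix : σ (y / x) = y / x := by
      have hσx : σ x ≠ 0 := by simpa using hx0
      rw [map_div₀, div_eq_div_iff hσx hx0]
      apply mul_left_cancel₀ hα
      linear_combination x * hy - y * hx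
    obtain ⟨c, hc⟩ := hσ _ hfix
    refine ⟨c, Subtype.ext ?_⟩
    change c • x = y
    rw [Algebra.smul_def, hc, div_mul_cancel₀ _ hx0]
  · push Not at hbot
    have : LinearMap.ker (α • σ.toLinearMap + β • (LinearMap.id : L →ₗ[K] L)) = ⊥ := by
      rw [Submodule.eq_bot_iff]
      intro x hx
      by_contra hx0
      exact hbot x hx0 (by simpa using hx)
    rw [this]
    simp

theorem exists_galois_generator [Finite L] :
    ∃ σ : Gal(L/K), ∀ x : L, σ x = x → x ∈ Set.range (algebraMap K L) := by
  have : Finite K := Finite.of_injective _ (algebraMap K L).injective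
  obtain ⟨σ, hσ⟩ := IsCyclic.exists_generator (α := Gal(L/K))
  refine ⟨σ, fun x hx => (IsGalois.mem_range_algebraMap_iff_fixed x).2 fun τ => ?_⟩
  have : Subgroup.zpowers σ ≤ MulAction.stabilizer Gal(L/K) x := by
    rw [Subgroup.zpowers_le]
    exact hx
  exact this (hσ τ)

/-- Every `K`-hyperplane of `L` can be scaled into any other one. -/
theorem exists_mul_mem_of_finrank_lt [FiniteDimensional K L] {A R : Submodule K L}
    (hA : finrank K A < finrank K L) (hR : finrank K R + 1 = finrank K L) :
    ∃ c : L, c ≠ 0 ∧ ∀ a ∈ A, c * a ∈ R := by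
  obtain ⟨l, hl0, hl⟩ := A.exists_le_ker_of_lt_top
    (lt_of_le_of_ne le_top (by rintro rfl; simp at hA))
  obtain ⟨t, ht0, ht⟩ := R.exists_le_ker_of_lt_top
    (lt_of_le_of_ne le_top (by rintro rfl; simp at hR))
  have hRt : R = LinearMap.ker t := by
    refine Submodule.eq_of_le_of_finrank_le ht ?_
    have := Module.Dual.finrank_ker_add_one_of_ne_zero ht0
    lia
  -- Every functional on `L` has the form `x ↦ t (c * x)`, since `m` is injective between spaces of
  -- equal dimension.
  let m : L →ₗ[K] Dual K L := (LinearMap.llcomp K L L K t).comp (LinearMap.mul K L)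
  have hm : ∀ c x, m c x = t (c * x) := fun c x => rfl
  have hinj : Function.Injective m := by
    rw [injective_iff_map_eq_zero]
    intro c hc
    by_contra hc0
    apply ht0
    ext x
    have := LinearMap.congr_fun hc (c⁻¹ * x)
    rwa [hm, mul_inv_cancel_left₀ hc0] at this
  obtain ⟨c, hc⟩ := (LinearMap.injective_iff_surjective_of_finrank_eq_finrank
    (Subspace.dual_finrank_eq (K := K) (V := L)).symm).1 hinj l
  refine ⟨c, ?_, fun a ha => ?_⟩
  · rintro rfl
    exact hl0 (by simpa using hc.symm)
  · rw [hRt, LinearMap.mem_ker, ← hm, hc]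
    exact hl ha

end SemilinearKernel

/-! ### Injective lifts through a map with kernel `K` -/

section CoveringRadius

variable {K L M : Type*} [Field K] [Field L] [Algebra K L] [AddCommGroup M] [Module K M]

theorem exists_comp_eq_of_finrank_ker_eq_one [FiniteDimensional K M] {N : Type*}
    [AddCommGroup N] [Module K N] (d : L →ₗ[K] N) (hd : d 1 = 0) (φ : M →ₗ[K] N)
    (hker : finrank K (LinearMap.ker φ) = 1) (hdker : ∀ x, d x = 0 → x ∈ Set.range (algebraMap K L))
    (hφ : LinearMap.range φ ≤ LinearMap.range d) :
    ∃ g : M →ₗ[K] L, Function.Injective g ∧ d ∘ₗ g = φ := by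
  obtain ⟨g₀, hg₀⟩ := Module.projective_lifting_property d.rangeRestrict
    (φ.codRestrict (LinearMap.range d) fun x => hφ ⟨x, rfl⟩) d.surjective_rangeRestrict
  replace hg₀ : ∀ x, d (g₀ x) = φ x := fun x => congrArg Subtype.val (LinearMap.congr_fun hg₀ x)
  obtain ⟨⟨k, hk⟩, hk0, hspan⟩ := finrank_eq_one_iff'.1 hker
  have hk0' : k ≠ 0 := fun h => hk0 (Subtype.ext h)
  obtain ⟨a, ha⟩ := hdker (g₀ k) (by rw [hg₀]; exact hk)
  obtain ⟨l, hl⟩ := Module.Projective.exists_dual_eq_one K hk0'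
  -- The lift `g₀` sends `k` into `K = ker d`, so changing its value there to 1 leaves `d ∘ g`
  -- unchanged and makes the lift injective.
  let g : M →ₗ[K] L := g₀ + (LinearMap.toSpanSingleton K L (1 - g₀ k)) ∘ₗ l
  have hg : ∀ x, d (g x) = φ x := fun x => by
    have : φ k = 0 := hk
    simp [g, hg₀, hd, this]
  refine ⟨g, ?_, LinearMap.ext hg⟩
  rw [injective_iff_map_eq_zero]
  intro x hx
  have hxk : φ x = 0 := by rw [← hg, hx, map_zero]
  obtain ⟨b, hb⟩ := hspan ⟨x, hxk⟩
  replace hb : b • k = x := congrArg Subtype.val hb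
  have hgk : g k = 1 := by simp [g, hl]
  rw [← hb, map_smul, hgk] at hx
  have : b = 0 := by simpa using hx
  rw [← hb, this, zero_smul]

end CoveringRadius

/-! ### Covering radius of a one-dimensional rank metric code -/

section CoveringRadiusMain

variable {K L M : Type*} [Field K] [Field L] [Algebra K L] [AddCommGroup M] [Module K M]

/-- With `b 0, b 1` a basis of `A = range φ`, the spaces `(b i)⁻¹ A` share the element 1, so their
sum misses some `t`. Twisting `ψ` by `b 0 * t` makes any two-dimensional kernel put `t` into that
sum. -/
theorem exists_ker_sub_smul_of_finrank_ker_eq_two [FiniteDimensional K M] [FiniteDimensional K L]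
    (hL : finrank K L = 4) (hM : finrank K M = 4) (φ : M →ₗ[K] L)
    (hker : finrank K (LinearMap.ker φ) = 2) :
    ∃ ψ : M →ₗ[K] L, ∀ μ : L, finrank K (LinearMap.ker (ψ - μ • φ)) ≤ 1 := by
  have hA : finrank K (LinearMap.range φ) = 2 := by
    have := φ.finrank_range_add_finrank_ker
    lia
  set N := LinearMap.ker φ with hN
  set A := LinearMap.range φ with hAdef
  let b : Basis (Fin 2) K A := finBasisOfFinrankEq K A hA
  have hb0 : ∀ i, (b i : L) ≠ 0 := fun i h => b.ne_zero i (Subtype.ext h)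
  let scaled (i : Fin 2) : Submodule K L := A.map (LinearMap.mulLeft K (b i : L)⁻¹)
  have hscaled (i : Fin 2) : finrank K (scaled i) = 2 := by
    rw [← hA]
    exact (Submodule.equivMapOfInjective _
      (mul_right_injective₀ (inv_ne_zero (hb0 i))) A).finrank_eq.symm
  have hone : (1 : L) ∈ scaled 0 ⊓ scaled 1 :=
    ⟨⟨b 0, (b 0).2, inv_mul_cancel₀ (hb0 0)⟩, ⟨b 1, (b 1).2, inv_mul_cancel₀ (hb0 1)⟩⟩
  have hlt : scaled 0 ⊔ scaled 1 < ⊤ := by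
    refine lt_of_le_of_ne le_top fun htop => ?_
    have h := Submodule.finrank_sup_add_finrank_inf_eq (scaled 0) (scaled 1)
    rw [htop, finrank_top, hL, hscaled, hscaled] at h
    have hbot : scaled 0 ⊓ scaled 1 = ⊥ := by
      rw [← Submodule.finrank_eq_zero (R := K)]
      lia
    rw [hbot] at hone
    exact one_ne_zero ((Submodule.mem_bot K).1 hone)
  obtain ⟨t, -, ht⟩ := SetLike.exists_of_lt hlt
  obtain ⟨π, hπ⟩ := N.subtype.exists_leftInverse_of_injective N.ker_subtype
  have hπN : ∀ n : N, π n = n := fun n => LinearMap.congr_fun hπ n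
  let e : N ≃ₗ[K] A := LinearEquiv.ofFinrankEq _ _ (by rw [hker, hA])
  let ψ : M →ₗ[K] L := A.subtype ∘ₗ e.toLinearMap ∘ₗ π +
    (LinearMap.toSpanSingleton K L (b 0 * t)) ∘ₗ b.coord 0 ∘ₗ φ.rangeRestrict
  have hψ : ∀ x, ψ x = (e (π x) : L) + b.coord 0 (φ.rangeRestrict x) • ((b 0 : L) * t) :=
    fun x => rfl
  refine ⟨ψ, fun μ => ?_⟩
  by_contra! hP
  set P := LinearMap.ker (ψ - μ • φ) with hPdef
  have hPmem : ∀ x ∈ P, ψ x = μ * φ x := fun x hx => by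
    have : ψ x - μ * φ x = 0 := hx
    exact sub_eq_zero.1 this
  -- On `N` the map `ψ - μ • φ` is the injective `e`, so `P` meets `N` trivially.
  have hinj : Function.Injective (φ.rangeRestrict ∘ₗ P.subtype) := by
    rw [injective_iff_map_eq_zero]
    rintro ⟨x, hx⟩ hx0
    have hxN : φ.rangeRestrict x = 0 := hx0
    have hφx : φ x = 0 := congrArg Subtype.val hxN
    have h1 := hPmem x hx
    rw [hψ, hxN, hφx, map_zero, zero_smul, add_zero, mul_zero] at h1
    have h2 : π x = 0 := e.map_eq_zero_iff.1 (Subtype.ext h1)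
    have h3 : (⟨x, hφx⟩ : N) = 0 := by rw [← hπN ⟨x, hφx⟩]; exact h2
    exact Subtype.ext (Subtype.ext_iff.1 h3 : x = 0)
  have hPA : finrank K P = finrank K A := by
    have : finrank K P ≤ finrank K A := LinearMap.finrank_le_finrank_of_injective hinj
    lia
  have hsurj := (LinearMap.injective_iff_surjective_of_finrank_eq_finrank hPA).1 hinj
  obtain ⟨⟨p, hp⟩, hp0⟩ := hsurj (b 0)
  obtain ⟨⟨r, hr⟩, hr1⟩ := hsurj (b 1)
  have hp0' : φ.rangeRestrict p = b 0 := hp0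
  have hr1' : φ.rangeRestrict r = b 1 := hr1
  have hφp : φ p = b 0 := congrArg Subtype.val hp0'
  have hφr : φ r = b 1 := congrArg Subtype.val hr1'
  have h0 := hPmem p hp
  have h1 := hPmem r hr
  rw [hψ, hp0', hφp] at h0
  rw [hψ, hr1', hφr] at h1
  simp only [Basis.coord_apply, Basis.repr_self, Finsupp.single_eq_same, one_smul] at h0
  simp only [Basis.coord_apply, Basis.repr_self, ne_eq, zero_ne_one,
    not_false_eq_true, Finsupp.single_eq_of_ne, zero_smul, add_zero] at h1
  apply ht
  have : t = (b 0 : L)⁻¹ * ((-e (π p) : A) : L) + (b 1 : L)⁻¹ * (e (π r) : L) := by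
    have := hb0 0
    have := hb0 1
    push_cast
    field_simp
    linear_combination (b 1 : L) * h0 - (b 0 : L) * h1
  rw [this]
  exact Submodule.add_mem_sup ⟨_, (-e (π p)).2, rfl⟩ ⟨_, (e (π r)).2, rfl⟩

/-- The rank metric code spanned by a single `K`-linear map has covering radius at least three. -/
theorem exists_ker_sub_smul_finrank_le_one [Finite L] [FiniteDimensional K M]
    (hL : finrank K L = 4) (hM : finrank K M = 4) (φ : M →ₗ[K] L) :
    ∃ ψ : M →ₗ[K] L, ∀ μ : L, finrank K (LinearMap.ker (ψ - μ • φ)) ≤ 1 := by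
  have : FiniteDimensional K L := FiniteDimensional.of_finrank_pos (by lia)
  obtain ⟨σ, hσ⟩ := exists_galois_generator (K := K) (L := L)
  have comp_le (d : L →ₗ[K] L) (hd : finrank K (LinearMap.ker d) ≤ 1) (g : M →ₗ[K] L)
      (hg : Function.Injective g) : finrank K (LinearMap.ker (d ∘ₗ g)) ≤ 1 := by
    rw [LinearMap.ker_comp]
    refine le_trans (LinearMap.finrank_le_finrank_of_injective
      (f := (g ∘ₗ Submodule.subtype _).codRestrict (LinearMap.ker d) fun x => x.2) ?_) hd
    intro x y hxy
    exact Subtype.ext (hg (congrArg Subtype.val hxy))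
  rcases Nat.lt_or_ge 2 (finrank K (LinearMap.ker φ)) with h3 | h2
  -- Here `φ` has rank at most 1, so any isomorphism serves as `ψ`.
  · let e : M ≃ₗ[K] L := LinearEquiv.ofFinrankEq _ _ (hM.trans hL.symm)
    refine ⟨e, fun μ => ?_⟩
    have hdisj : LinearMap.ker (e.toLinearMap - μ • φ) ⊓ LinearMap.ker φ = ⊥ := by
      rw [Submodule.eq_bot_iff]
      rintro x ⟨hx, hx0⟩
      have hx0' : φ x = 0 := hx0
      have : e x - μ * φ x = 0 := hx
      simpa [hx0'] using this
    have h := Submodule.finrank_sup_add_finrank_inf_eq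
      (LinearMap.ker (e.toLinearMap - μ • φ)) (LinearMap.ker φ)
    rw [hdisj, finrank_bot] at h
    have := Submodule.finrank_le (LinearMap.ker (e.toLinearMap - μ • φ) ⊔ LinearMap.ker φ)
    lia
  interval_cases hk : finrank K (LinearMap.ker φ)
  · have hinj : Function.Injective φ := LinearMap.ker_eq_bot.1 (Submodule.finrank_eq_zero.1 hk)
    refine ⟨σ.toLinearMap ∘ₗ φ, fun μ => ?_⟩
    have heq : σ.toLinearMap ∘ₗ φ - μ • φ =
        ((1 : L) • σ.toLinearMap + (-μ) • (LinearMap.id : L →ₗ[K] L)) ∘ₗ φ := by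
      ext x
      simp [sub_eq_add_neg]
    rw [heq]
    exact comp_le _ (finrank_ker_smul_add_smul_le_one σ hσ (by simp)) φ hinj
  -- Both `range φ` and `range (σ - 1)` are hyperplanes; after scaling, `c φ = (σ - 1) g` with `g`
  -- injective, and `g - μ φ` is a binomial in `σ` composed with `g`.
  · let d : L →ₗ[K] L := σ.toLinearMap - LinearMap.id
    have hd : ∀ x, d x = σ x - x := fun x => rfl
    have hdker : finrank K (LinearMap.ker d) = 1 := by
      apply le_antisymm
      · have heq : d = (1 : L) • σ.toLinearMap + (-1 : L) • (LinearMap.id : L →ₗ[K] L) := by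
          ext x
          simp [d, sub_eq_add_neg]
        rw [heq]
        exact finrank_ker_smul_add_smul_le_one σ hσ (by simp)
      · rw [Nat.one_le_iff_ne_zero, ne_eq, Submodule.finrank_eq_zero, Submodule.eq_bot_iff]
        intro h
        exact one_ne_zero (h 1 (by simp [hd]))
    obtain ⟨c, hc0, hc⟩ := exists_mul_mem_of_finrank_lt
      (A := LinearMap.range φ) (R := LinearMap.range d)
      (by have := φ.finrank_range_add_finrank_ker; lia)
      (by have := d.finrank_range_add_finrank_ker; lia)
    have hcker : LinearMap.ker (c • φ) = LinearMap.ker φ := by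
      ext x
      simp [hc0]
    obtain ⟨g, hg, hdg⟩ := exists_comp_eq_of_finrank_ker_eq_one d (by simp [hd]) (c • φ)
      (by rw [hcker, hk]) (fun x hx => hσ x (sub_eq_zero.1 hx))
      (by rintro _ ⟨x, rfl⟩; exact hc _ ⟨x, rfl⟩)
    refine ⟨g, fun μ => ?_⟩
    have heq : g - μ • φ =
        ((-(μ / c)) • σ.toLinearMap + (1 + μ / c) • (LinearMap.id : L →ₗ[K] L)) ∘ₗ g := by
      ext x
      have hx : σ (g x) - g x = c * φ x := LinearMap.congr_fun hdg x
      simp only [LinearMap.sub_apply, LinearMap.smul_apply, LinearMap.comp_apply,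
        LinearMap.add_apply, smul_eq_mul, LinearMap.id_apply, AlgEquiv.toLinearMap_apply]
      field_simp
      linear_combination μ * hx
    rw [heq]
    refine comp_le _ (finrank_ker_smul_add_smul_le_one σ hσ ?_) g hg
    by_cases h : μ / c = 0 <;> simp [h]
  · exact exists_ker_sub_smul_of_finrank_ker_eq_two hL hM φ hk

end CoveringRadiusMain

/-! ### Saturation in vector form, and the lower bound -/

section Saturating

variable {K L V : Type*} [Field K] [Field L] [AddCommGroup V] [Module K V] [Module L V]

theorem Projectivization.mk_mem_span_pair_iff {a b v : V} (ha : a ≠ 0) (hb : b ≠ 0) (hv : v ≠ 0) :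
    Projectivization.mk L v hv ∈ Projectivization.Subspace.span
      (Set.range ![Projectivization.mk L a ha, Projectivization.mk L b hb]) ↔
      v ∈ Submodule.span L {a, b} := by
  rw [Projectivization.Subspace.mem_span]
  constructor
  · intro h
    refine (Submodule.mk_mem_projectivization_iff _ hv).1 (h _ ?_)
    rintro _ ⟨i, rfl⟩
    fin_cases i
    · exact (Submodule.mk_mem_projectivization_iff _ ha).2 (Submodule.subset_span (by simp))
    · exact (Submodule.mk_mem_projectivization_iff _ hb).2 (Submodule.subset_span (by simp))
  · intro h W hW
    rw [← Projectivization.Subspace.mem_submodule_iff]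
    refine (Submodule.span_le (p := Projectivization.Subspace.submodule W)).2 ?_ h
    rintro _ (rfl | rfl)
    · exact (Projectivization.Subspace.mem_submodule_iff _ ha).2 (hW ⟨0, rfl⟩)
    · exact (Projectivization.Subspace.mem_submodule_iff _ hb).2 (hW ⟨1, rfl⟩)

theorem isSaturating_one_linearSet_iff (U : Submodule K V) :
    IsSaturating 1 (linearSet L U) ↔ ∀ v : V, v ≠ 0 →
      ∃ a ∈ U, ∃ b ∈ U, LinearIndependent L ![a, b] ∧ v ∈ Submodule.span L {a, b} := by
  constructor
  · intro h v hv
    obtain ⟨p, hp, hind, hmem⟩ := h (Projectivization.mk L v hv)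
    obtain ⟨a, ha0, ha, hpa⟩ := hp 0
    obtain ⟨b, hb0, hb, hpb⟩ := hp 1
    have hp' : p = ![Projectivization.mk L a ha0, Projectivization.mk L b hb0] := by
      ext i
      fin_cases i
      · simp [hpa]
      · simp [hpb]
    rw [hp'] at hind hmem
    exact ⟨a, ha, b, hb, (Projectivization.independent_mk_iff_LinearIndependent ha0 hb0).1 hind,
      (Projectivization.mk_mem_span_pair_iff ha0 hb0 hv).1 hmem⟩
  · intro h P
    induction P with
    | h v hv =>
      obtain ⟨a, ha, b, hb, hind, hmem⟩ := h v hv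
      have ha0 : a ≠ 0 := hind.ne_zero 0
      have hb0 : b ≠ 0 := hind.ne_zero 1
      refine ⟨![Projectivization.mk L a ha0, Projectivization.mk L b hb0], fun i => ?_,
        (Projectivization.independent_mk_iff_LinearIndependent ha0 hb0).2 hind,
        (Projectivization.mk_mem_span_pair_iff ha0 hb0 hv).2 hmem⟩
      fin_cases i
      · exact ⟨a, ha0, ha, rfl⟩
      · exact ⟨b, hb0, hb, rfl⟩

theorem Submodule.exists_family_of_finrank_le (U : Submodule K V) [FiniteDimensional K U] {n : ℕ}
    (hU : finrank K U ≤ n) :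
    ∃ u : Fin n → V, ∀ a ∈ U, ∃ c : Fin n → K, ∑ i, c i • u i = a := by
  let b := finBasis K U
  -- Padding with zeros treats all ranks up to `n` at once.
  let u : Fin n → V := fun i => if h : (i : ℕ) < finrank K U then b ⟨i, h⟩ else 0
  refine ⟨u, fun a ha => ?_⟩
  rw [← Submodule.mem_span_range_iff_exists_fun]
  have hle : Submodule.span K (Set.range fun i => (b i : V)) ≤ Submodule.span K (Set.range u) := by
    rw [Submodule.span_le]
    rintro _ ⟨i, rfl⟩
    exact Submodule.subset_span ⟨⟨i, i.2.trans_le hU⟩, by simp [u]⟩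
  apply hle
  rw [Submodule.mem_span_range_iff_exists_fun]
  exact ⟨b.repr ⟨a, ha⟩, by
    simpa only [map_sum, map_smul, Submodule.subtype_apply] using
      congrArg U.subtype (b.sum_repr ⟨a, ha⟩)⟩

/-- In a projective plane over a finite extension of degree four, a saturating linear set has rank
at least five. -/
theorem not_isSaturating_of_finrank_le_four [Algebra K L] [IsScalarTower K L V] [Finite L]
    (hL : finrank K L = 4) (hV : finrank L V = 3) (U : Submodule K V) [FiniteDimensional K U]
    (hU : finrank K U ≤ 4) : ¬ IsSaturating 1 (linearSet L U) := by
  rw [isSaturating_one_linearSet_iff]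
  intro h
  have : FiniteDimensional L V := FiniteDimensional.of_finrank_pos (by lia)
  obtain ⟨u, hu⟩ := U.exists_family_of_finrank_le hU
  let F : (Fin 4 → L) →ₗ[L] V := Fintype.linearCombination L u
  have hF : ∀ x, F x = ∑ i, x i • u i := fun x => rfl
  have hUF : ∀ a ∈ U, ∃ c : Fin 4 → K, F (fun i => algebraMap K L (c i)) = a := by
    intro a ha
    obtain ⟨c, hc⟩ := hu a ha
    exact ⟨c, by simpa [hF] using hc⟩
  have hsurj : LinearMap.range F = ⊤ := by
    by_contra htop
    obtain ⟨v, -, hv⟩ := SetLike.exists_of_lt (lt_of_le_of_ne le_top htop)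
    obtain ⟨a, ha, b, hb, -, hmem⟩ := h v (by rintro rfl; exact hv (zero_mem _))
    refine hv ((Submodule.span_le.2 ?_) hmem)
    obtain ⟨c, hc⟩ := hUF a ha
    obtain ⟨d, hd⟩ := hUF b hb
    rintro _ (rfl | rfl)
    · exact ⟨_, hc⟩
    · exact ⟨_, hd⟩
  have hker : finrank L (LinearMap.ker F) = 1 := by
    have := F.finrank_range_add_finrank_ker
    rw [hsurj, finrank_top, hV, Module.finrank_fin_fun] at this
    lia
  obtain ⟨⟨w, hw⟩, -, hspan⟩ := finrank_eq_one_iff'.1 hker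
  have hkerw : ∀ x, F x = 0 → ∃ μ : L, μ • w = x := fun x hx => by
    obtain ⟨μ, hμ⟩ := hspan ⟨x, hx⟩
    exact ⟨μ, congrArg Subtype.val hμ⟩
  let φ : (Fin 4 → K) →ₗ[K] L := Fintype.linearCombination K w
  have hφ : ∀ i, φ (Pi.single i 1) = w i := fun i => by simp [φ]
  obtain ⟨ψ, hψ⟩ := exists_ker_sub_smul_finrank_le_one hL (Module.finrank_fin_fun K) φ
  let x : Fin 4 → L := fun i => ψ (Pi.single i 1)
  have hx : F x ≠ 0 := by
    intro hx
    obtain ⟨μ, hμ⟩ := hkerw x hx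
    have : ψ - μ • φ = 0 := by
      refine LinearMap.pi_ext' fun i => LinearMap.ext_ring ?_
      have hi : μ * w i = ψ (Pi.single i 1) := congrFun hμ i
      simp [hφ, hi]
    have h1 := hψ μ
    rw [this, LinearMap.ker_zero, finrank_top, Module.finrank_fin_fun] at h1
    lia
  obtain ⟨a, ha, b, hb, -, hmem⟩ := h _ hx
  obtain ⟨α, β, hαβ⟩ := Submodule.mem_span_pair.1 hmem
  obtain ⟨c, rfl⟩ := hUF a ha
  obtain ⟨d, rfl⟩ := hUF b hb
  obtain ⟨μ, hμ⟩ := hkerw (x - (α • (fun i => algebraMap K L (c i)) +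
    β • (fun i => algebraMap K L (d i)))) (by rw [map_sub, map_add, map_smul, map_smul, hαβ, sub_self])
  -- Factoring through `K × K` bounds the rank of `ψ - μ • φ` by 2.
  let θ : (Fin 4 → K) →ₗ[K] K × K :=
    (Fintype.linearCombination K c).prod (Fintype.linearCombination K d)
  let κ : K × K →ₗ[K] L :=
    (LinearMap.toSpanSingleton K L α).coprod (LinearMap.toSpanSingleton K L β)
  have hκθ : ψ - μ • φ = κ ∘ₗ θ := by
    refine LinearMap.pi_ext' fun i => LinearMap.ext_ring ?_
    have hi := congrFun hμ i
    simp only [Pi.smul_apply, smul_eq_mul, Pi.sub_apply, Pi.add_apply] at hi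
    simp [hφ, θ, κ, Algebra.smul_def]
    linear_combination -hi
  have h1 := hψ μ
  have h2 := (ψ - μ • φ).finrank_range_add_finrank_ker
  have h3 : finrank K (LinearMap.range (ψ - μ • φ)) ≤ 2 := by
    rw [hκθ]
    refine (Submodule.finrank_mono (LinearMap.range_comp_le_range θ κ)).trans ?_
    simpa using κ.finrank_range_le
  rw [Module.finrank_fin_fun] at h2
  lia

end Saturating

/-! ### The quadratic subplane and the rank 5 example -/

section SubfieldPlane

variable {K L : Type*} [Field K] [Field L] [Algebra K L]

/-- A vector over a quadratic extension `L / F` lies on the `L`-line spanned by two independent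
vectors with coordinates in `F`. -/
theorem exists_linearIndependent_pair_mem_span {F : IntermediateField K L}
    (hF : finrank F L = 2) {n : ℕ} (hn : 2 ≤ n) {v : Fin n → L} (hv : v ≠ 0) :
    ∃ r s : Fin n → F, LinearIndependent L ![fun i => (r i : L), fun i => (s i : L)] ∧
      v ∈ Submodule.span L {fun i => (r i : L), fun i => (s i : L)} := by
  have : Nontrivial (Fin n) := Fin.nontrivial_iff_two_le.2 hn
  have : FiniteDimensional F L := FiniteDimensional.of_finrank_pos (by lia)
  let b := finBasisOfFinrankEq F L hF
  let r (j : Fin 2) : Fin n → F := fun i => b.repr (v i) j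
  have hvr : b 0 • (fun i => (r 0 i : L)) + b 1 • (fun i => (r 1 i : L)) = v := by
    ext i
    have := b.sum_repr (v i)
    rw [Fin.sum_univ_two, IntermediateField.smul_def, IntermediateField.smul_def] at this
    simpa [r, mul_comm] using this
  by_cases hind : LinearIndependent L ![fun i => (r 0 i : L), fun i => (r 1 i : L)]
  · exact ⟨r 0, r 1, hind, Submodule.mem_span_pair.2 ⟨_, _, hvr⟩⟩
  -- If the two coordinate vectors are dependent, `v` is a multiple of an `F`-rational vector, and
  -- any second rational point completes a line.
  obtain ⟨s, c, hc⟩ : ∃ (s : Fin n → F) (c : L), c • (fun i => (s i : L)) = v := by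
    rw [LinearIndependent.pair_iff] at hind
    push Not at hind
    obtain ⟨x, y, hxy, h0⟩ := hind
    by_cases hx : x = 0
    · have hy := h0 hx
      refine ⟨r 0, b 0 - b 1 * x / y, ?_⟩
      ext i
      rw [← hvr]
      have := congrFun hxy i
      simp only [Pi.add_apply, Pi.smul_apply, smul_eq_mul, Pi.zero_apply] at this ⊢
      field_simp
      linear_combination -b 1 * this
    · refine ⟨r 1, b 1 - b 0 * y / x, ?_⟩
      ext i
      rw [← hvr]
      have := congrFun hxy i
      simp only [Pi.add_apply, Pi.smul_apply, smul_eq_mul, Pi.zero_apply] at this ⊢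
      field_simp
      linear_combination -b 0 * this
  obtain ⟨i, hi⟩ : ∃ i, (s i : L) ≠ 0 := by
    by_contra! h
    apply hv
    rw [← hc]
    ext i
    simp [h i]
  obtain ⟨j, hj⟩ := exists_ne i
  refine ⟨s, Pi.single j 1, ?_, Submodule.mem_span_pair.2 ⟨c, 0, by simpa using hc⟩⟩
  rw [LinearIndependent.pair_iff]
  intro x y hxy
  have hxi := congrFun hxy i
  have hyj := congrFun hxy j
  simp only [Pi.add_apply, Pi.smul_apply, smul_eq_mul, Pi.zero_apply, Pi.single_apply,
    hj.symm, if_false, if_true, ZeroMemClass.coe_zero, OneMemClass.coe_one, mul_zero,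
    add_zero, mul_one, mul_eq_zero, hi, or_false] at hxi hyj
  exact ⟨hxi, by simpa [hxi] using hyj⟩

/-- A hyperplane over `K` of the subplane over the quadratic intermediate field meets every point
of that subplane, hence defines a saturating linear set. -/
theorem exists_finrank_eq_five_isSaturating [Finite L] (hL : finrank K L = 4) :
    ∃ U : Submodule K (Fin 3 → L), finrank K U = 5 ∧ IsSaturating 1 (linearSet L U) := by
  have : FiniteDimensional K L := FiniteDimensional.of_finrank_pos (by lia)
  have : Finite K := Finite.of_injective _ (algebraMap K L).injective
  obtain ⟨p, hp⟩ := CharP.exists K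
  have : Fact p.Prime := ⟨CharP.char_is_prime K p⟩
  obtain ⟨j⟩ := FiniteField.nonempty_algHom_of_finrank_dvd
    (F := K) (K := FiniteField.Extension K p 2) (L := L)
    (by rw [FiniteField.finrank_extension, hL]; norm_num)
  let F : IntermediateField K L := j.fieldRange
  have hKF : finrank K F = 2 := by
    rw [← FiniteField.finrank_extension K p 2]
    exact (AlgEquiv.ofInjectiveField j).toLinearEquiv.finrank_eq.symm
  have hFL : finrank F L = 2 := by
    have := finrank_mul_finrank K F L
    rw [hKF, hL] at this
    lia
  obtain ⟨l, hl⟩ := Module.Projective.exists_dual_ne_zero K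
    (show (fun _ => 1 : Fin 3 → F) ≠ 0 from fun h => one_ne_zero (congrFun h 0))
  replace hl : l ≠ 0 := by
    rintro rfl
    exact hl rfl
  have hmeet (a : Fin 3 → F) : ∃ m : F, m ≠ 0 ∧ m • a ∈ LinearMap.ker l := by
    let g : F →ₗ[K] K := l ∘ₗ (LinearMap.toSpanSingleton F (Fin 3 → F) a).restrictScalars K
    -- One `K`-linear condition on `m` in the two-dimensional `F`.
    have hg : LinearMap.ker g ≠ ⊥ := LinearMap.ker_ne_bot_of_finrank_lt (by rw [hKF]; simp)
    obtain ⟨m, hm, hm0⟩ := Submodule.exists_mem_ne_zero_of_ne_bot hg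
    exact ⟨m, hm0, hm⟩
  let ι : (Fin 3 → F) →ₗ[K] (Fin 3 → L) := F.val.toLinearMap.compLeft (Fin 3)
  have hι : ∀ a, ι a = fun i => (a i : L) := fun a => rfl
  have hιinj : Function.Injective ι := fun a b hab =>
    funext fun i => Subtype.ext (congrFun hab i)
  refine ⟨(LinearMap.ker l).map ι, ?_, ?_⟩
  · rw [← (Submodule.equivMapOfInjective ι hιinj _).finrank_eq]
    have := Module.Dual.finrank_ker_add_one_of_ne_zero hl
    rw [Module.finrank_pi_fintype] at this
    simp only [hKF, Finset.sum_const, Finset.card_univ, Fintype.card_fin, smul_eq_mul] at this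
    lia
  · rw [isSaturating_one_linearSet_iff]
    intro v hv
    obtain ⟨r, s, hind, hmem⟩ :=
      exists_linearIndependent_pair_mem_span hFL (by norm_num) hv
    obtain ⟨m, hm0, hm⟩ := hmeet r
    obtain ⟨n, hn0, hn⟩ := hmeet s
    have hm0' : (m : L) ≠ 0 := by simpa using hm0
    have hn0' : (n : L) ≠ 0 := by simpa using hn0
    have hmr : ι (m • r) = (m : L) • fun i => (r i : L) := rfl
    have hns : ι (n • s) = (n : L) • fun i => (s i : L) := rfl
    refine ⟨_, ⟨_, hm, hmr⟩, _, ⟨_, hn, hns⟩, ?_, ?_⟩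
    · rw [LinearIndependent.pair_iff] at hind ⊢
      intro x y hxy
      simpa [hm0, hn0] using hind (x * m) (y * n) (by simpa only [mul_smul] using hxy)
    · obtain ⟨x, y, hxy⟩ := Submodule.mem_span_pair.1 hmem
      refine Submodule.mem_span_pair.2 ⟨x / m, y / n, ?_⟩
      rw [smul_smul, smul_smul, div_mul_cancel₀ _ hm0', div_mul_cancel₀ _ hn0', hxy]

end SubfieldPlane

/-- For every prime power `q`, the smallest rank of a `1`-saturating `𝔽_q`-linear set of
`PG(2, q ^ 4)` is `5`. -/
theorem theorem3p4 (q : ℕ) (hq : IsPrimePow q) (K L : Type*) [Field K] [Field L] [Algebra K L]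
    (hK : Nat.card K = q) (hL : Nat.card L = q ^ 4) :
    IsLeast (saturatingRanks K L 3 1) 5 := by
  have : Finite L := Nat.finite_of_card_ne_zero (by rw [hL]; exact pow_ne_zero _ hq.ne_zero)
  have : Finite K := Finite.of_injective _ (algebraMap K L).injective
  have hKL : finrank K L = 4 := by
    refine Nat.pow_right_injective hq.two_le ?_
    change q ^ finrank K L = q ^ 4
    rw [← hL, ← hK, Module.natCard_eq_pow_finrank (K := K) (V := L)]
  refine ⟨exists_finrank_eq_five_isSaturating hKL, ?_⟩
  rintro n ⟨U, rfl, hU⟩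
  by_contra! hlt
  exact not_isSaturating_of_finrank_le_four hKL (Module.finrank_fin_fun L) U (by lia) hU
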